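/- Let $\mathcal M\subseteq\mathbb R^n$ be a smooth embedded submanifold of dimension $d$ with the Euclidean metric, let $R$ be a smooth retraction on $\mathcal M$ defined on the whole tangent bundle, and put $\mathcal T_{R_{\eta}}\xi=\frac{d}{dt}R_x(\eta+t\xi)|_{t=0}$ for $\eta,\xi\in T_x\mathcal M$. Let $F=f+g$ with $f:\mathcal M\to\mathbb R$ differentiable and $g:\mathbb R^n\to\mathbb R$, and let $x_0\in\mathcal M$. Assume: (i) $F$ is bounded below on $\mathcal M$ and $\Omega_{x_0}=\{x\in\mathcal M: F(x)\le F(x_0)\}$ is compact; (ii) $f$ is $L$-retraction-smooth in $\Omega_{x_0}$, i.e. $f(R_x(\eta))\le f(x)+\langle\operatorname{grad}f(x),\eta\rangle+\frac L2\|\eta\|^2$ whenever $x\in\Omega_{x_0}$, $\eta\in T_x\mathcal M$ and $R_x(\eta)\in\Omega_{x_0}$; (iii) $g$ is convex and Lipschitz continuous on $\mathbb R^n$; (iv) $g$ is retraction-convex on $\mathcal M$, i.e. for every $x\in\mathcal M$ and every $\xi\in T_x\mathcal M$ there is $\zeta\in T_x\mathcal M$ with $g(R_x(\eta))\ge g(R_x(\xi))+\langle\zeta,\eta-\xi\rangle$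 for all $\eta\in T_x\mathcal M$. Then there is $L_0$ such that for every $\tilde L>L_0$ there is a constant $\tilde a>0$ with the following property. For $x\in\mathcal M$ let $Q_x:\mathbb R^d\to T_x\mathcal M$ be a linear isometry onto $T_x\mathcal M$, and put $$\ell_x(\eta)=\langle\operatorname{grad}f(x),\eta\rangle+\tfrac{\tilde L}2\|\eta\|^2+g(R_x(\eta)),\qquad J_x(c)=\ell_x(Q_xc),$$ $$\tilde r_x(c)\in\operatorname*{arg\,min}_{v\in\mathbb R^d}\ \langle v,Q_x^T\operatorname{grad}f(x)+\tilde Lc\rangle+\tfrac{\tilde L}2\|\mathcal T_{R_{Q_xc}}Q_xv\|^2+g\bigl(R_x(Q_xc)+\mathcal T_{R_{Q_xc}}Q_xv\bigr).$$ Let $(\bar c_k)$ in $\mathbb R^d$ and $(x_k)$ satisfy, with $\bar\eta_k=Q_{x_k}\bar c_k$, $x_{k+1}=R_{x_k}(\bar\eta_k)$ and $J_{x_k}(\bar c_k)\le J_{x_k}(0)$ for all $k\ge0$. Let $\mathcal S$ be the set of accumulation points of $(x_k)$, and assume that $x\mapsto Q_x$ is smooth on a neighbourhood of $\mathcal S$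 in $\mathcal M$ (a parallelizable neighbourhood). Let $\tilde r_{x_k}(\bar c_k)$ be minimizers as above, let $\eta_k^*\in T_{x_k}\mathcal M$ be a stationary point of $\ell_{x_k}$ (that is, $0$ lies in its Clarke subdifferential at $\eta_k^*$), and let $\varepsilon_k>0$. Then: 1. If $\varrho\in\mathbb R$, $\psi:\mathbb R^3\to\mathbb R$ and $\|\tilde r_{x_k}(\bar c_k)\|\le\psi(\varepsilon_k,\varrho,\|\bar c_k\|)$ for all $k$, then there is an integer $\tilde K>0$ such that $\|\bar\eta_k-\eta_k^*\|\le\tilde a\,\psi(\varepsilon_k,\varrho,\|\bar\eta_k\|)$ for all $k>\tilde K$. 2. If $\|\tilde r_{x_k}(\bar c_k)\|\le\varepsilon_k^2$ for all $k$, then there is $\kappa>0$ with $\|\bar\eta_k-\eta_k^*\|\le(\kappa\varepsilon_k)^2$ for all $k$. 3. Put $\beta=(\tilde L-L)/2$ and let $L_F>0$ and $\varrho<\frac{\beta}{2L_F\tilde a}$. If $\|\tilde r_{x_k}(\bar c_k)\|\le\min(\varepsilon_k^2,\varrho\|\bar c_k\|^2)$ for all $k$, then there is an integer $\tilde K>0$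 such that $\|\bar\eta_k-\eta_k^*\|\le\min\bigl((\sqrt{\tilde a}\,\varepsilon_k)^2,\frac{\beta}{2L_F}\|\bar\eta_k\|^2\bigr)$ for all $k>\tilde K$. -/

import Mathlib

open Filter Topology
open scoped ContDiff NNReal

noncomputable section

namespace IRPG

section Manifold

variable {E : Type*} [NormedAddCommGroup E] [InnerProductSpace ℝ E]

/-- `M` is a smooth embedded submanifold of dimension `d` of the Euclidean space `E`: around each
of its points there is a smooth slice chart, that is, a diffeomorphism between open subsets of `E`
that maps `M` onto a `d`-dimensional linear subspace. -/
def IsEmbeddedSubmanifold (d : ℕ) (M : Set E) : Prop :=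
  ∀ x ∈ M, ∃ (φ : OpenPartialHomeomorph E E) (V : Submodule ℝ E),
    x ∈ φ.source ∧ ContDiffOn ℝ ∞ φ φ.source ∧ ContDiffOn ℝ ∞ φ.symm φ.target ∧
      Module.finrank ℝ V = d ∧ ∀ y ∈ φ.source, y ∈ M ↔ φ y ∈ V

/-- The tangent space `T_x M`: the velocities at `x` of smooth curves in `M` through `x`. For an
embedded submanifold these already form a linear subspace; the span only makes this part of
the type. It carries the inner product of `E`, which is the Riemannian metric. -/
def tangentSpace (M : Set E) (x : E) : Submodule ℝ E :=
  Submodule.span ℝ {v | ∃ γ : ℝ → E, ContDiffAt ℝ ∞ γ 0 ∧ (∀ᶠ t in 𝓝 (0 : ℝ), γ t ∈ M) ∧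
    γ 0 = x ∧ HasDerivAt γ v 0}

/-- The tangent bundle `TM`, as a subset of `E × E`. -/
def tangentBundle (M : Set E) : Set (E × E) :=
  {p | p.1 ∈ M ∧ p.2 ∈ tangentSpace M p.1}

/-- `R` is a (globally defined, smooth) retraction on `M`; only the values `R x η` with `x ∈ M` and
`η ∈ T_x M` matter. -/
structure IsRetraction (M : Set E) (R : E → E → E) : Prop where
  mapsTo : ∀ x ∈ M, ∀ η ∈ tangentSpace M x, R x η ∈ M
  smooth : ContDiffOn ℝ ∞ (fun p : E × E => R p.1 p.2) (tangentBundle M)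
  map_zero : ∀ x ∈ M, R x 0 = x
  hasDerivAt : ∀ x ∈ M, ∀ η ∈ tangentSpace M x, HasDerivAt (fun t : ℝ => R x (t • η)) η 0

/-- The vector transport by differentiated retraction,
`𝒯_{R_η} ξ = d/dt R_x(η + t ξ) |_{t = 0}`. -/
def diffRetraction (R : E → E → E) (x η ξ : E) : E :=
  deriv (fun t : ℝ => R x (η + t • ξ)) 0

/-- The Riemannian gradient: the unique `grad f(x) ∈ T_x M` with
`D f(x)[η] = ⟨grad f(x), η⟩` for all `η ∈ T_x M`. -/
def riemGrad [FiniteDimensional ℝ E] (M : Set E) (f : E → ℝ) (x : E) : tangentSpace M x :=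
  haveI := FiniteDimensional.complete ℝ (tangentSpace M x)
  (InnerProductSpace.toDual ℝ (tangentSpace M x)).symm
    ((fderivWithin ℝ f M x).comp (tangentSpace M x).subtypeL)

/-- `h` is `L`-retraction-smooth with respect to `R` in `N ⊆ M`. -/
def RetractionSmooth [FiniteDimensional ℝ E] (M : Set E) (R : E → E → E) (N : Set E) (L : ℝ)
    (h : E → ℝ) : Prop :=
  ∀ x ∈ N, ∀ T : Set (tangentSpace M x), (∀ η ∈ T, R x η ∈ N) →
    ∀ η ∈ T, h (R x η) ≤ h x + inner ℝ (riemGrad M h x) η + L / 2 * ‖η‖ ^ 2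

/-- `h` is retraction-convex with respect to `R` in `N ⊆ M`; the vector `ζ` is a subgradient of
`h ∘ R_x` at `ξ`. -/
def RetractionConvex (M : Set E) (R : E → E → E) (N : Set E) (h : E → ℝ) : Prop :=
  ∀ x ∈ N, ∀ T : Set (tangentSpace M x), (∀ η ∈ T, R x η ∈ N) →
    ∀ ξ ∈ T, ∃ ζ : tangentSpace M x, ∀ η ∈ T, h (R x η) ≥ h (R x ξ) + inner ℝ ζ (η - ξ)

/-- The accumulation points in `M` of a sequence. -/
def accPoints (M : Set E) (x : ℕ → E) : Set E :=
  {p | p ∈ M ∧ MapClusterPt p atTop x}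

/-- `Q` is a field of orthonormal bases: for `x ∈ M`, `Q x` is a linear isometry of `ℝ^d`
onto `T_x M`. -/
def IsFrame {d : ℕ} (M : Set E) (Q : E → EuclideanSpace ℝ (Fin d) →ₗᵢ[ℝ] E) : Prop :=
  ∀ x ∈ M, LinearMap.range (Q x).toLinearMap = tangentSpace M x

/-- `U` is a parallelizable set for the frame `Q`: `Q` is smooth in `U`. -/
def IsParallelizable {d : ℕ} (Q : E → EuclideanSpace ℝ (Fin d) →ₗᵢ[ℝ] E) (U : Set E) : Prop :=
  ContDiffOn ℝ ∞ (fun x => (Q x).toContinuousLinearMap) U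

end Manifold

section Clarke

variable {T : Type*} [NormedAddCommGroup T] [InnerProductSpace ℝ T]

/-- Clarke's generalized directional derivative
`h°(η; v) = limsup_{ξ → η, t ↓ 0} (h(ξ + t v) - h(ξ)) / t`. -/
def clarkeDeriv (h : T → ℝ) (η v : T) : EReal :=
  limsup (fun p : T × ℝ => (((h (p.1 + p.2 • v) - h p.1) / p.2 : ℝ) : EReal))
    (𝓝 η ×ˢ 𝓝[>] (0 : ℝ))

/-- Clarke's generalized subdifferential. -/
def clarkeSubdiff (h : T → ℝ) (η : T) : Set T :=
  {ζ | ∀ v : T, ((inner ℝ ζ v : ℝ) : EReal) ≤ clarkeDeriv h η v}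

end Clarke

section Algorithm

variable {E : Type*} [NormedAddCommGroup E] [InnerProductSpace ℝ E] [FiniteDimensional ℝ E]

/-- The model `ℓ_x(η) = ⟨grad f(x), η⟩ + (L̃/2) ‖η‖² + g(R_x(η))` on `T_x M`. -/
def proxModel (M : Set E) (R : E → E → E) (f g : E → ℝ) (Lt : ℝ) (x : E)
    (η : tangentSpace M x) : ℝ :=
  inner ℝ (riemGrad M f x) η + Lt / 2 * ‖η‖ ^ 2 + g (R x η)

/-- The same model in the coordinates of the frame,
`J_x(c) = ⟨Q_xᵀ grad f(x), c⟩ + (L̃/2) ‖c‖² + g(R_x(Q_x c))` on `ℝ^d`. -/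
def proxModelCoord {d : ℕ} (M : Set E) (R : E → E → E) (f g : E → ℝ) (Lt : ℝ)
    (Q : E → EuclideanSpace ℝ (Fin d) →ₗᵢ[ℝ] E) (x : E) (c : EuclideanSpace ℝ (Fin d)) : ℝ :=
  inner ℝ (riemGrad M f x : E) (Q x c) + Lt / 2 * ‖c‖ ^ 2 + g (R x (Q x c))

/-- The linearized model
`w̃_{x,c}(v) = ⟨v, Q_xᵀ grad f(x) + L̃ c⟩ + (L̃/2) ‖𝒯 Q_x v‖² + g(y + 𝒯 Q_x v)`, where
`y = R_x(Q_x c)` and `𝒯 = 𝒯_{R_{Q_x c}}`. -/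
def linModel {d : ℕ} (M : Set E) (R : E → E → E) (f g : E → ℝ) (Lt : ℝ)
    (Q : E → EuclideanSpace ℝ (Fin d) →ₗᵢ[ℝ] E) (x : E) (c v : EuclideanSpace ℝ (Fin d)) : ℝ :=
  inner ℝ (Q x v) ((riemGrad M f x : E) + Lt • Q x c)
    + Lt / 2 * ‖diffRetraction R x (Q x c) (Q x v)‖ ^ 2
    + g (R x (Q x c) + diffRetraction R x (Q x c) (Q x v))

/-- `v` is a value of the residual map: `v = r̃_x(c)` minimizes the linearized model over `ℝ^d`. -/
def IsLinResidual {d : ℕ} (M : Set E) (R : E → E → E) (f g : E → ℝ) (Lt : ℝ)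
    (Q : E → EuclideanSpace ℝ (Fin d) →ₗᵢ[ℝ] E) (x : E) (c v : EuclideanSpace ℝ (Fin d)) : Prop :=
  IsMinOn (linModel M R f g Lt Q x c) Set.univ v

/-- `x` is the sequence of iterates started at `x₀` with the search directions
`Q_{x_k} c_k`, each of which does not increase the proximal model. -/
structure IsIterates {d : ℕ} (M : Set E) (R : E → E → E) (f g : E → ℝ) (Lt : ℝ)
    (Q : E → EuclideanSpace ℝ (Fin d) →ₗᵢ[ℝ] E) (x₀ : E) (x : ℕ → E)
    (c : ℕ → EuclideanSpace ℝ (Fin d)) : Prop where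
  init : x 0 = x₀
  step : ∀ k, x (k + 1) = R (x k) (Q (x k) (c k))
  descent : ∀ k, proxModelCoord M R f g Lt Q (x k) (c k) ≤ proxModelCoord M R f g Lt Q (x k) 0

end Algorithm

end IRPG

end


/-!
Retraction-convexity of `g` makes the proximal model strongly convex on `T_x M`, so its Clarke
stationary point `η⋆` is its minimizer. Testing the first-order conditions of `η⋆` and of the
linearized residual `r` at `η` against each other yields
`L̃ (‖e‖² - ⟪e, r⟫ - ⟪A r, A e⟫ + ‖A r‖²) ≤ L_g C (‖e‖² + ‖r‖²)` with `e = η⋆ - η` and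
`A = D R_x(η)`, because the two models differ by at most `L_g` times the second-order Taylor
remainder of `R_x`. As soon as `2 L_g C ≤ L̃` the right-hand side is absorbed and `‖e‖ ≤ a ‖r‖`.

The constant `C` is uniform: a large `L̃` keeps the iterates in the compact sublevel set `Ω`, where
the gradient of `f` is bounded, and forces `‖η‖, ‖η⋆‖ ≤ 1`, so only a compact disc bundle over `Ω`
matters.
-/

set_option maxSynthPendingDepth 3

namespace IRPG

section Convex

variable {V W E : Type*} [NormedAddCommGroup V] [InnerProductSpace ℝ V]
  [NormedAddCommGroup W] [InnerProductSpace ℝ W] [NormedAddCommGroup E] [NormedSpace ℝ E]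

theorem convexOn_of_forall_exists_subgradient {h : V → ℝ}
    (hsub : ∀ ξ, ∃ ζ : V, ∀ η, h ξ + inner ℝ ζ (η - ξ) ≤ h η) : ConvexOn ℝ Set.univ h := by
  refine ⟨convex_univ, fun x _ y _ a b ha hb hab => ?_⟩
  set z := a • x + b • y with hz
  obtain ⟨ζ, hζ⟩ := hsub z
  have hbalance : a * inner ℝ ζ (x - z) + b * inner ℝ ζ (y - z) = 0 := by
    have hsum : a • (x - z) + b • (y - z) = z - (a + b) • z := by rw [hz]; module
    rw [← inner_smul_right, ← inner_smul_right, ← inner_add_right, hsum, hab, one_smul, sub_self,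
      inner_zero_right]
  calc h z = a * (h z + inner ℝ ζ (x - z)) + b * (h z + inner ℝ ζ (y - z)) := by
        linear_combination (-h z) * hab - hbalance
    _ ≤ a • h x + b • h y := by
        rw [smul_eq_mul, smul_eq_mul]
        gcongr
        exacts [hζ x, hζ y]

theorem sub_le_mul_sub_of_convexOn {s : Set E} {h : E → ℝ} (hconv : ConvexOn ℝ s h) {x v : E}
    (hx : x ∈ s) (hxv : x + v ∈ s) {t : ℝ} (ht₀ : 0 ≤ t) (ht₁ : t ≤ 1) :
    h (x + t • v) - h x ≤ t * (h (x + v) - h x) := by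
  have hle := hconv.2 hx hxv (sub_nonneg.2 ht₁) ht₀ (by ring)
  rw [show (1 - t) • x + t • (x + v) = x + t • v by module, smul_eq_mul, smul_eq_mul] at hle
  linarith

theorem le_add_inner_of_isMinOn {φ : V → ℝ} (hφ : ConvexOn ℝ Set.univ φ) {b : V} {A : V →L[ℝ] W}
    {l : ℝ} {u : V}
    (hu : IsMinOn (fun z => inner ℝ b z + l / 2 * ‖A z‖ ^ 2 + φ z) Set.univ u) (v : V) :
    φ u ≤ φ (u + v) + inner ℝ b v + l * inner ℝ (A u) (A v) := by
  let q : ℝ → ℝ := fun t =>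
    inner ℝ b v + l * inner ℝ (A u) (A v) + l / 2 * ‖A v‖ ^ 2 * t + (φ (u + v) - φ u)
  have hq : ∀ᶠ t in 𝓝[>] 0, 0 ≤ q t := by
    filter_upwards [Ioo_mem_nhdsGT (zero_lt_one (α := ℝ))] with t ⟨ht₀, ht₁⟩
    have hmin := isMinOn_univ_iff.1 hu (u + t • v)
    have hsec := sub_le_mul_sub_of_convexOn hφ (Set.mem_univ u) (Set.mem_univ (u + v)) ht₀.le ht₁.le
    rw [map_add, map_smul, norm_add_sq_real, norm_smul, inner_add_right, inner_smul_right,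
      inner_smul_right, Real.norm_of_nonneg ht₀.le] at hmin
    refine nonneg_of_mul_nonneg_right (a := t) ?_ ht₀
    simp only [q]
    nlinarith
  have hlim : Tendsto q (𝓝[>] 0) (𝓝 (q 0)) :=
    (Continuous.tendsto (by fun_prop) 0).mono_left nhdsWithin_le_nhds
  have hq₀ := ge_of_tendsto hlim hq
  simp only [q, mul_zero, add_zero] at hq₀
  linarith

theorem isMinOn_of_zero_mem_clarkeSubdiff {h : V → ℝ} (hconv : ConvexOn ℝ Set.univ h)
    (hcont : Continuous h) {η : V} (h₀ : 0 ∈ clarkeSubdiff h η) : IsMinOn h Set.univ η := by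
  refine isMinOn_univ_iff.2 fun z => le_of_forall_pos_le_add fun δ hδ => ?_
  obtain ⟨v, rfl⟩ : ∃ v, z = η + v := ⟨z - η, by abel⟩
  have hlim : Tendsto (fun ξ => h (ξ + v) - h ξ) (𝓝 η) (𝓝 (h (η + v) - h η)) :=
    Continuous.tendsto (by fun_prop) η
  have hquot : ∀ᶠ p : V × ℝ in 𝓝 η ×ˢ 𝓝[>] (0 : ℝ),
      (((h (p.1 + p.2 • v) - h p.1) / p.2 : ℝ) : EReal) ≤ ((h (η + v) - h η + δ : ℝ) : EReal) := by
    filter_upwards [(hlim.eventually_lt_const (lt_add_of_pos_right _ hδ)).prod_mk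
      (Ioo_mem_nhdsGT (zero_lt_one (α := ℝ)))] with ⟨ξ, t⟩ ⟨hξ, ht₀, ht₁⟩
    rw [EReal.coe_le_coe_iff, div_le_iff₀' ht₀]
    exact (sub_le_mul_sub_of_convexOn hconv (Set.mem_univ ξ) (Set.mem_univ _) ht₀.le ht₁.le).trans
      (mul_le_mul_of_nonneg_left hξ.le ht₀.le)
  have hle := (h₀ v).trans (limsup_le_of_le (h := hquot))
  rw [inner_zero_left, EReal.coe_le_coe_iff] at hle
  linarith

theorem sub_mul_norm_le_of_convexOn_comp {G : V → E} {g : E → ℝ} {K : ℝ≥0}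
    (hg : LipschitzWith K g) (hconv : ConvexOn ℝ Set.univ (g ∘ G)) {v : V} {w : E}
    (hG : HasDerivAt (fun t : ℝ => G (t • v)) w 0) : g (G 0) - K * ‖w‖ ≤ g (G v) := by
  have hslope : Tendsto (fun t : ℝ => K * ‖t⁻¹ • (G (t • v) - G 0)‖) (𝓝[>] 0) (𝓝 (K * ‖w‖)) := by
    simpa using ((hG.tendsto_slope_zero.mono_left (nhdsGT_le_nhdsNE 0)).norm).const_mul (K : ℝ)
  have hbound : g (G 0) - g (G v) ≤ K * ‖w‖ := by
    refine ge_of_tendsto hslope ?_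
    filter_upwards [Ioo_mem_nhdsGT (zero_lt_one (α := ℝ))] with t ⟨ht₀, ht₁⟩
    have hsec := sub_le_mul_sub_of_convexOn hconv (Set.mem_univ 0) (Set.mem_univ (0 + v))
      ht₀.le ht₁.le
    simp only [zero_add, Function.comp_apply] at hsec
    have hdist : g (G 0) - g (G (t • v)) ≤ K * ‖G (t • v) - G 0‖ := by
      rw [← dist_eq_norm, dist_comm]
      exact (le_abs_self _).trans (hg.dist_le_mul (G 0) (G (t • v)))
    rw [norm_smul, norm_inv, Real.norm_of_nonneg ht₀.le, ← mul_assoc, mul_comm (K : ℝ), mul_assoc,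
      le_inv_mul_iff₀ ht₀]
    linarith
  linarith

theorem inner_sub_le_of_isMinOn {Ψ φ : V → ℝ} (hΨ : ConvexOn ℝ Set.univ Ψ)
    (hφ : ConvexOn ℝ Set.univ φ) {b c e r : V} {A : V →L[ℝ] W} {l : ℝ}
    (hu : IsMinOn (fun z => inner ℝ b z + l / 2 * ‖z‖ ^ 2 + Ψ z) Set.univ (c + e))
    (hr : IsMinOn (fun z => inner ℝ (b + l • c) z + l / 2 * ‖A z‖ ^ 2 + φ z) Set.univ r) :
    l * (‖e‖ ^ 2 - inner ℝ e r - inner ℝ (A r) (A e) + ‖A r‖ ^ 2) ≤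
      (Ψ (c + r) - φ r) - (Ψ (c + e) - φ e) := by
  have htest_r := le_add_inner_of_isMinOn hφ hr (e - r)
  have htest_u := le_add_inner_of_isMinOn (A := ContinuousLinearMap.id ℝ V) hΨ hu (r - e)
  rw [add_sub_cancel] at htest_r
  rw [show c + e + (r - e) = c + r by abel] at htest_u
  simp only [ContinuousLinearMap.id_apply, map_sub, inner_add_left, inner_sub_right,
    real_inner_smul_left, real_inner_self_eq_norm_sq] at htest_r htest_u
  linarith

theorem norm_le_mul_norm_of_inner_sub_le {e r : V} {A : V →L[ℝ] W} {B : ℝ} (hA : ‖A‖ ≤ B)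
    (hre : ‖r‖ ≤ ‖e‖)
    (h : ‖e‖ ^ 2 - inner ℝ e r - inner ℝ (A r) (A e) + ‖A r‖ ^ 2 ≤ (‖e‖ ^ 2 + ‖r‖ ^ 2) / 2) :
    ‖e‖ ≤ (2 * B ^ 2 + 3) * ‖r‖ := by
  have hAre : inner ℝ (A r) (A e) ≤ B ^ 2 * (‖e‖ * ‖r‖) :=
    calc inner ℝ (A r) (A e) ≤ ‖A r‖ * ‖A e‖ := real_inner_le_norm _ _
      _ ≤ (B * ‖r‖) * (B * ‖e‖) := by
          have hB : 0 ≤ B := (norm_nonneg A).trans hA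
          gcongr
          exacts [A.le_of_opNorm_le hA r, A.le_of_opNorm_le hA e]
      _ = B ^ 2 * (‖e‖ * ‖r‖) := by ring
  have hmul : ‖e‖ * ‖e‖ ≤ ‖e‖ * ((2 * B ^ 2 + 3) * ‖r‖) := by
    have hrr : ‖r‖ ^ 2 ≤ ‖e‖ * ‖r‖ := by
      rw [sq]
      exact mul_le_mul_of_nonneg_right hre (norm_nonneg r)
    linarith [real_inner_le_norm e r, sq_nonneg ‖A r‖]
  rcases (norm_nonneg e).eq_or_lt with he | he
  · rw [← he]
    positivity
  · exact le_of_mul_le_mul_left hmul he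

theorem norm_sub_le_mul_norm_of_isMinOn {Ψ φ : V → ℝ} (hΨ : ConvexOn ℝ Set.univ Ψ)
    (hφ : ConvexOn ℝ Set.univ φ) {b c u r : V} {A : V →L[ℝ] W} {l B K ρ : ℝ} (hl : 0 < l)
    (hK : 2 * K ≤ l) (hA : ‖A‖ ≤ B)
    (hmodel : ∀ v, ‖v‖ ≤ ρ → |Ψ (c + v) - φ v| ≤ K * ‖v‖ ^ 2) (huc : ‖u - c‖ ≤ ρ)
    (hu : IsMinOn (fun z => inner ℝ b z + l / 2 * ‖z‖ ^ 2 + Ψ z) Set.univ u)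
    (hr : IsMinOn (fun z => inner ℝ (b + l • c) z + l / 2 * ‖A z‖ ^ 2 + φ z) Set.univ r) :
    ‖u - c‖ ≤ (2 * B ^ 2 + 3) * ‖r‖ := by
  obtain ⟨e, rfl⟩ : ∃ e, u = c + e := ⟨u - c, by abel⟩
  rw [add_sub_cancel_left] at huc ⊢
  rcases le_total ‖e‖ ‖r‖ with her | hre
  · nlinarith [norm_nonneg r, mul_nonneg (sq_nonneg B) (norm_nonneg r)]
  refine norm_le_mul_norm_of_inner_sub_le hA hre (le_of_mul_le_mul_left ?_ hl)
  have he_model := (abs_le.1 (hmodel e huc)).1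
  have hr_model := (abs_le.1 (hmodel r (hre.trans huc))).2
  calc l * (‖e‖ ^ 2 - inner ℝ e r - inner ℝ (A r) (A e) + ‖A r‖ ^ 2)
      ≤ (Ψ (c + r) - φ r) - (Ψ (c + e) - φ e) := inner_sub_le_of_isMinOn hΨ hφ hu hr
    _ ≤ K * (‖e‖ ^ 2 + ‖r‖ ^ 2) := by linarith
    _ ≤ l / 2 * (‖e‖ ^ 2 + ‖r‖ ^ 2) := by
        gcongr
        linarith
    _ = l * ((‖e‖ ^ 2 + ‖r‖ ^ 2) / 2) := by ring

end Convex

section Calculus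

variable {V X W : Type*} [NormedAddCommGroup V] [NormedSpace ℝ V] [NormedAddCommGroup X]
  [NormedSpace ℝ X] [NormedAddCommGroup W] [NormedSpace ℝ W]

theorem norm_sub_sub_fderiv_le {G : V → W} (hG : ContDiff ℝ 2 G) {s : Set V} (hs : Convex ℝ s)
    {C : ℝ} (hC : ∀ z ∈ s, ‖fderiv ℝ (fderiv ℝ G) z‖ ≤ C) {x y : V} (hx : x ∈ s) (hy : y ∈ s) :
    ‖G y - G x - fderiv ℝ G x (y - x)‖ ≤ C * ‖y - x‖ ^ 2 := by
  have hG₁ : Differentiable ℝ G := hG.differentiable (by simp)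
  have hG₂ : Differentiable ℝ (fderiv ℝ G) :=
    (hG.fderiv_right (m := 1) (by norm_num)).differentiable (by simp)
  have hC₀ : 0 ≤ C := (norm_nonneg (fderiv ℝ (fderiv ℝ G) x)).trans (hC x hx)
  have hfderiv : ∀ z ∈ segment ℝ x y, ‖fderiv ℝ G z - fderiv ℝ G x‖ ≤ C * ‖y - x‖ := fun z hz =>
    calc ‖fderiv ℝ G z - fderiv ℝ G x‖ ≤ C * ‖z - x‖ :=
          hs.norm_image_sub_le_of_norm_fderiv_le (fun z _ => hG₂ z) hC hx
            (hs.segment_subset hx hy hz)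
      _ ≤ C * ‖y - x‖ := by
          gcongr
          exact norm_sub_le_of_mem_segment hz
  calc ‖G y - G x - fderiv ℝ G x (y - x)‖ ≤ C * ‖y - x‖ * ‖y - x‖ :=
        (convex_segment x y).norm_image_sub_le_of_norm_fderiv_le' (𝕜 := ℝ) (fun z _ => hG₁ z)
          hfderiv (left_mem_segment ℝ x y) (right_mem_segment ℝ x y)
    _ = C * ‖y - x‖ ^ 2 := by ring

theorem exists_eventually_hasFDerivWithinAt_two {Φ : X → W} {S : Set X} {p : X}
    (hΦ : ContDiffWithinAt ℝ 2 Φ S p) (hp : p ∈ S) :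
    ∃ (Φ₁ : X → X →L[ℝ] W) (Φ₂ : X → X →L[ℝ] X →L[ℝ] W) (C : ℝ), ∀ᶠ q in 𝓝[S] p,
      HasFDerivWithinAt Φ (Φ₁ q) S q ∧ HasFDerivWithinAt Φ₁ (Φ₂ q) S q ∧
        ‖Φ₁ q‖ ≤ C ∧ ‖Φ₂ q‖ ≤ C := by
  obtain ⟨u₁, hu₁, -, -, Φ₁, hΦ₁, hcont₁⟩ :=
    (contDiffWithinAt_succ_iff_hasFDerivWithinAt' (n := 1) (by simp)).1 hΦ
  obtain ⟨u₂, hu₂, -, -, Φ₂, hΦ₂, hcont₂⟩ :=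
    (contDiffWithinAt_succ_iff_hasFDerivWithinAt' (n := 0) (by simp)).1 (by simpa using hcont₁)
  rw [Set.insert_eq_of_mem hp] at hu₁ hu₂
  refine ⟨Φ₁, Φ₂, max (‖Φ₁ p‖ + 1) (‖Φ₂ p‖ + 1), ?_⟩
  filter_upwards [hu₁, hu₂,
    hcont₁.continuousWithinAt.norm.eventually_lt_const (lt_add_one _),
    hcont₂.continuousWithinAt.norm.eventually_lt_const (lt_add_one _)] with q h₁ h₂ hb₁ hb₂
  exact ⟨hΦ₁ q h₁, hΦ₂ q h₂, le_max_of_le_left hb₁.le, le_max_of_le_right hb₂.le⟩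

section AffineSlice

variable {Φ : X → W} {S : Set X} {ι : V → X} {J : V →L[ℝ] X}

theorem norm_fderiv_comp_slice_le {Φ' : X →L[ℝ] W} {v : V} (hι : HasFDerivAt ι J v)
    (hιS : ∀ w, ι w ∈ S) (hJ : ‖J‖ ≤ 1) (hΦ : HasFDerivWithinAt Φ Φ' S (ι v)) :
    ‖fderiv ℝ (Φ ∘ ι) v‖ ≤ ‖Φ'‖ := by
  rw [(hΦ.comp_hasFDerivAt v hι (Eventually.of_forall hιS)).fderiv]
  exact (Φ'.opNorm_comp_le J).trans (mul_le_of_le_one_right (norm_nonneg _) hJ)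

theorem norm_fderiv_fderiv_comp_slice_le {Φ₁ : X → X →L[ℝ] W} {Φ₂ : X →L[ℝ] X →L[ℝ] W} {v : V}
    (hι : ∀ w, HasFDerivAt ι J w) (hιS : ∀ w, ι w ∈ S) (hJ : ‖J‖ ≤ 1)
    (hΦ₁ : ∀ᶠ q in 𝓝[S] (ι v), HasFDerivWithinAt Φ (Φ₁ q) S q)
    (hΦ₂ : HasFDerivWithinAt Φ₁ Φ₂ S (ι v)) :
    ‖fderiv ℝ (fderiv ℝ (Φ ∘ ι)) v‖ ≤ ‖Φ₂‖ := by
  have hιv : Tendsto ι (𝓝 v) (𝓝[S] (ι v)) :=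
    tendsto_nhdsWithin_iff.2 ⟨(hι v).continuousAt, Eventually.of_forall hιS⟩
  have hfderiv : fderiv ℝ (Φ ∘ ι) =ᶠ[𝓝 v] fun w => (Φ₁ (ι w)).comp J := by
    filter_upwards [hιv.eventually hΦ₁] with w hw
    exact (hw.comp_hasFDerivAt w (hι w) (Eventually.of_forall hιS)).fderiv
  let precompJ : (X →L[ℝ] W) →L[ℝ] V →L[ℝ] W := (ContinuousLinearMap.compL ℝ V X W).flip J
  have hprecompJ : ∀ T, ‖precompJ T‖ ≤ ‖T‖ := fun T =>
    (T.opNorm_comp_le J).trans (mul_le_of_le_one_right (norm_nonneg _) hJ)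
  have hsecond : HasFDerivAt (fderiv ℝ (Φ ∘ ι)) (precompJ.comp (Φ₂.comp J)) v :=
    (precompJ.hasFDerivAt.comp v
      (hΦ₂.comp_hasFDerivAt v (hι v) (Eventually.of_forall hιS))).congr_of_eventuallyEq hfderiv
  rw [hsecond.fderiv]
  refine ContinuousLinearMap.opNorm_le_bound _ (norm_nonneg Φ₂) fun w => (hprecompJ _).trans ?_
  exact Φ₂.le_opNorm_of_le ((J.le_of_opNorm_le hJ w).trans_eq (one_mul _))

end AffineSlice

theorem mem_of_hasDerivAt_of_eventually_mem {K : Submodule ℝ W} (hK : IsClosed (K : Set W))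
    {γ : ℝ → W} {w : W} {t₀ : ℝ} (hγ : HasDerivAt γ w t₀) (hmem : ∀ᶠ t in 𝓝 t₀, γ t ∈ K) :
    w ∈ K := by
  have hshift : ∀ᶠ t in 𝓝 (0 : ℝ), γ (t₀ + t) ∈ K :=
    (Continuous.tendsto' (by fun_prop : Continuous (t₀ + ·)) 0 t₀ (add_zero t₀)).eventually hmem
  refine hK.mem_of_tendsto hγ.tendsto_slope_zero ?_
  filter_upwards [nhdsWithin_le_nhds hshift] with t ht
  exact K.smul_mem _ (K.sub_mem ht hmem.self_of_nhds)

theorem forall_mem_Icc_le_of_lt_of_le {h : ℝ → ℝ} (hh : Continuous h) {a b α : ℝ}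
    (ha : h a ≤ α) (hright : ∀ᶠ s in 𝓝[>] a, h s ≤ α)
    (hlt : ∀ s ∈ Set.Ioo a b, h s ≤ α → h s < α) : ∀ s ∈ Set.Icc a b, h s ≤ α := by
  refine IsClosed.Icc_subset_of_forall_mem_nhdsWithin (s := {s | h s ≤ α})
    ((isClosed_le hh continuous_const).inter isClosed_Icc) ha ?_
  rintro s ⟨hs, has, hsb⟩
  rcases has.eq_or_lt with rfl | has
  · exact hright
  · exact mem_nhdsWithin_of_mem_nhds
      ((hh.continuousAt.eventually_lt_const (hlt s ⟨has, hsb⟩ hs)).mono fun _ => le_of_lt)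

theorem exists_forall_mem_of_isCompact {Y ι : Type*} [TopologicalSpace Y] [SemilatticeSup ι]
    [Nonempty ι] {K : Set Y} (hK : IsCompact K) {P : ι → Y → Prop} (hmono : Monotone P)
    (hloc : ∀ p ∈ K, ∃ C, ∀ᶠ q in 𝓝[K] p, P C q) : ∃ C, ∀ q ∈ K, P C q :=
  hK.induction_on (p := fun t => ∃ C, ∀ q ∈ t, P C q)
    ⟨Classical.arbitrary ι, fun _ => False.elim⟩
    (fun _ _ hst ⟨C, hC⟩ => ⟨C, fun q hq => hC q (hst hq)⟩)
    (fun _ _ ⟨C, hC⟩ ⟨D, hD⟩ => ⟨C ⊔ D, fun q hq => hq.elim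
      (fun hq => hmono le_sup_left q (hC q hq))
      (fun hq => hmono le_sup_right q (hD q hq))⟩)
    (fun p hp => by
      obtain ⟨C, hC⟩ := hloc p hp
      exact ⟨{q | P C q}, hC, C, fun _ => id⟩)

end Calculus

section Tangent

variable {E : Type*} [NormedAddCommGroup E] [InnerProductSpace ℝ E]

theorem fderiv_symm_apply_fderiv {φ : OpenPartialHomeomorph E E}
    (hφ : DifferentiableOn ℝ φ φ.source) (hφs : DifferentiableOn ℝ φ.symm φ.target) {x : E}
    (hx : x ∈ φ.source) (v : E) : fderiv ℝ φ.symm (φ x) (fderiv ℝ φ x v) = v := by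
  have hd := (hφ.differentiableAt (φ.open_source.mem_nhds hx)).hasFDerivAt
  have hds := (hφs.differentiableAt (φ.open_target.mem_nhds (φ.map_source hx))).hasFDerivAt
  have hid : HasFDerivAt (φ.symm ∘ φ) (ContinuousLinearMap.id ℝ E) x :=
    (hasFDerivAt_id x).congr_of_eventuallyEq (φ.eventually_left_inverse hx)
  exact DFunLike.congr_fun ((hds.comp x hd).unique hid) v

section SliceChart

variable {M : Set E} {φ : OpenPartialHomeomorph E E} {K : Submodule ℝ E} {x : E}

theorem tangentSpace_le_comap_fderiv (hK : IsClosed (K : Set E))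
    (hφ : DifferentiableOn ℝ φ φ.source) (hslice : ∀ y ∈ φ.source, y ∈ M ↔ φ y ∈ K)
    (hx : x ∈ φ.source) : tangentSpace M x ≤ K.comap (fderiv ℝ φ x : E →ₗ[ℝ] E) := by
  have hd := (hφ.differentiableAt (φ.open_source.mem_nhds hx)).hasFDerivAt
  rw [tangentSpace, Submodule.span_le]
  rintro v ⟨γ, -, hγM, rfl, hγ⟩
  refine mem_of_hasDerivAt_of_eventually_mem (γ := φ ∘ γ) hK (hd.comp_hasDerivAt (0 : ℝ) hγ) ?_
  filter_upwards [hγM, hγ.continuousAt.eventually (φ.open_source.mem_nhds hx)] with t htM ht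
  exact (hslice _ ht).1 htM

theorem comap_fderiv_le_tangentSpace (hφ : DifferentiableOn ℝ φ φ.source)
    (hφs : ContDiffOn ℝ ∞ φ.symm φ.target) (hslice : ∀ y ∈ φ.source, y ∈ M ↔ φ y ∈ K)
    (hx : x ∈ φ.source) (hxM : x ∈ M) :
    K.comap (fderiv ℝ φ x : E →ₗ[ℝ] E) ≤ tangentSpace M x := by
  intro v hv
  set w := fderiv ℝ φ x v
  let line : ℝ → E := fun t => φ x + t • w
  have hline₀ : line 0 = φ x := by simp [line]
  have hline : HasDerivAt line w 0 := by
    simpa only [one_smul, id] using ((hasDerivAt_id (0 : ℝ)).smul_const w).const_add (φ x)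
  have hφs_line : ContDiffAt ℝ ∞ φ.symm (line 0) := by
    rw [hline₀]
    exact hφs.contDiffAt (φ.open_target.mem_nhds (φ.map_source hx))
  refine Submodule.subset_span ⟨φ.symm ∘ line, hφs_line.comp 0 (by fun_prop), ?_, ?_, ?_⟩
  · have htarget : ∀ᶠ t in 𝓝 (0 : ℝ), line t ∈ φ.target :=
      hline.continuousAt.eventually
        (φ.open_target.mem_nhds (by rw [hline₀]; exact φ.map_source hx))
    filter_upwards [htarget] with t ht
    rw [Function.comp_apply, hslice _ (φ.map_target ht), φ.right_inv ht]
    exact K.add_mem ((hslice x hx).1 hxM) (K.smul_mem _ hv)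
  · rw [Function.comp_apply, hline₀, φ.left_inv hx]
  · have hcomp := (hφs_line.differentiableAt (by simp)).hasFDerivAt.comp_hasDerivAt (0 : ℝ) hline
    rwa [hline₀, fderiv_symm_apply_fderiv hφ (hφs.differentiableOn (by simp)) hx] at hcomp

end SliceChart

/-- The closed disc bundle of radius `ρ` over `N`, as a subset of `E × E`; the estimates on the
retraction are uniform on it. -/
def discBundle (M N : Set E) (ρ : ℝ) : Set (E × E) :=
  {p | p.1 ∈ N ∧ p.2 ∈ tangentSpace M p.1 ∧ ‖p.2‖ ≤ ρ}

theorem discBundle_subset_tangentBundle {M N : Set E} (hNM : N ⊆ M) (ρ : ℝ) :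
    discBundle M N ρ ⊆ tangentBundle M :=
  fun _ hp => ⟨hNM hp.1, hp.2.1⟩

variable [FiniteDimensional ℝ E] {d : ℕ} {M : Set E}

theorem IsEmbeddedSubmanifold.mem_tangentBundle_of_mem_closure (hM : IsEmbeddedSubmanifold d M)
    {p : E × E} (hp : p ∈ closure (tangentBundle M)) (hpM : p.1 ∈ M) : p ∈ tangentBundle M := by
  obtain ⟨φ, K, hx, hφ, hφs, -, hslice⟩ := hM p.1 hpM
  have hK : IsClosed (K : Set E) := K.closed_of_finiteDimensional
  have hd : DifferentiableOn ℝ φ φ.source := hφ.differentiableOn (by simp)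
  have hfderiv : ContinuousAt (fderiv ℝ φ) p.1 :=
    (hφ.contDiffAt (φ.open_source.mem_nhds hx)).continuousAt_fderiv (by simp)
  have hcont : Tendsto (fun q : E × E => fderiv ℝ φ q.1 q.2) (𝓝[tangentBundle M] p)
      (𝓝 (fderiv ℝ φ p.1 p.2)) :=
    ((hfderiv.comp continuousAt_fst).clm_apply continuousAt_snd).tendsto.mono_left
      nhdsWithin_le_nhds
  refine ⟨hpM, comap_fderiv_le_tangentSpace hd hφs hslice hx hpM ?_⟩
  have := mem_closure_iff_nhdsWithin_neBot.1 hp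
  refine hK.mem_of_tendsto hcont ?_
  filter_upwards [self_mem_nhdsWithin,
    nhdsWithin_le_nhds (continuousAt_fst (φ.open_source.mem_nhds hx))] with q hq hq₁
  exact tangentSpace_le_comap_fderiv hK hd hslice hq₁ hq.2

theorem IsEmbeddedSubmanifold.isCompact_discBundle (hM : IsEmbeddedSubmanifold d M) {N : Set E}
    (hN : IsCompact N) (hNM : N ⊆ M) (ρ : ℝ) : IsCompact (discBundle M N ρ) := by
  have hK : IsCompact (N ×ˢ Metric.closedBall (0 : E) ρ) := hN.prod (isCompact_closedBall 0 ρ)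
  have hsub : discBundle M N ρ ⊆ N ×ˢ Metric.closedBall (0 : E) ρ :=
    fun p hp => ⟨hp.1, mem_closedBall_zero_iff.2 hp.2.2⟩
  refine hK.of_isClosed_subset (isClosed_of_closure_subset fun p hp => ?_) hsub
  have hpK := closure_minimal hsub hK.isClosed hp
  have hpT := hM.mem_tangentBundle_of_mem_closure
    (closure_mono (discBundle_subset_tangentBundle hNM ρ) hp) (hNM hpK.1)
  exact ⟨hpK.1, hpT.2, mem_closedBall_zero_iff.1 hpK.2⟩

end Tangent

section Retraction

variable {E : Type*} [NormedAddCommGroup E] [InnerProductSpace ℝ E] {M : Set E} {R : E → E → E}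
  {x : E}

/-- The retraction `R_x` on the tangent space at `x`, where its derivatives are taken. -/
def retractionAt (M : Set E) (R : E → E → E) (x : E) (η : tangentSpace M x) : E :=
  R x η

theorem IsRetraction.retractionAt_mem (hR : IsRetraction M R) (hx : x ∈ M)
    (η : tangentSpace M x) : retractionAt M R x η ∈ M :=
  hR.mapsTo x hx η η.2

theorem IsRetraction.retractionAt_zero (hR : IsRetraction M R) (hx : x ∈ M) :
    retractionAt M R x 0 = x :=
  hR.map_zero x hx

theorem IsRetraction.contDiff_retractionAt (hR : IsRetraction M R) (hx : x ∈ M) :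
    ContDiff ℝ 2 (retractionAt M R x) := by
  have hfibre : ContDiff ℝ ∞ fun η : tangentSpace M x => (x, (η : E)) :=
    contDiff_const.prodMk (tangentSpace M x).subtypeL.contDiff
  rw [← contDiffOn_univ]
  exact (hR.smooth.comp hfibre.contDiffOn fun η _ => ⟨hx, η.2⟩).of_le (by norm_cast)

theorem IsRetraction.differentiable_retractionAt (hR : IsRetraction M R) (hx : x ∈ M) :
    Differentiable ℝ (retractionAt M R x) :=
  (hR.contDiff_retractionAt hx).differentiable (by simp)

theorem IsRetraction.diffRetraction_eq_fderiv (hR : IsRetraction M R) (hx : x ∈ M)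
    (η ξ : tangentSpace M x) : diffRetraction R x η ξ = fderiv ℝ (retractionAt M R x) η ξ := by
  have hd := (hR.differentiable_retractionAt hx η).hasFDerivAt
  have hline : HasDerivAt (fun t : ℝ => η + t • ξ) ξ 0 := by
    simpa only [one_smul, id] using ((hasDerivAt_id (0 : ℝ)).smul_const ξ).const_add η
  exact (HasFDerivAt.comp_hasDerivAt (0 : ℝ)
    (by simpa only [zero_smul, add_zero] using hd) hline).deriv

/-- The first two derivatives of `R_x` at `η` are bounded by `C`, where `(x, η) = p`; a predicate on
`E × E`, so that compactness can be applied to all tangent spaces at once. -/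
def FibreDerivBound (M : Set E) (R : E → E → E) (C : ℝ) (p : E × E) : Prop :=
  ∀ η : tangentSpace M p.1, (η : E) = p.2 →
    ‖fderiv ℝ (retractionAt M R p.1) η‖ ≤ C ∧ ‖fderiv ℝ (fderiv ℝ (retractionAt M R p.1)) η‖ ≤ C

theorem FibreDerivBound.monotone : Monotone (FibreDerivBound M R) :=
  fun _ _ hCD _ hp η hη => ⟨(hp η hη).1.trans hCD, (hp η hη).2.trans hCD⟩

theorem IsRetraction.exists_eventually_fibreDerivBound (hR : IsRetraction M R) {p : E × E}
    (hp : p ∈ tangentBundle M) : ∃ C, ∀ᶠ q in 𝓝[tangentBundle M] p, FibreDerivBound M R C q := by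
  obtain ⟨Φ₁, Φ₂, C, hΦ⟩ := exists_eventually_hasFDerivWithinAt_two
    ((hR.smooth p hp).of_le (by norm_cast)) hp
  refine ⟨C, ?_⟩
  filter_upwards [self_mem_nhdsWithin, hΦ, eventually_eventually_nhdsWithin.2 hΦ]
  rintro ⟨x, ζ⟩ ⟨hx, -⟩ ⟨h₁, h₂, hC₁, hC₂⟩ hnear (η : tangentSpace M x)
    (rfl : (η : E) = ζ)
  let J : tangentSpace M x →L[ℝ] E × E :=
    (ContinuousLinearMap.inr ℝ E E).comp (tangentSpace M x).subtypeL
  have hJ : ‖J‖ ≤ 1 := J.opNorm_le_bound zero_le_one fun v => by simp [J]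
  have hι : ∀ η : tangentSpace M x, HasFDerivAt (fun η : tangentSpace M x => (x, (η : E))) J η :=
    fun η => (hasFDerivAt_const x η).prodMk (tangentSpace M x).subtypeL.hasFDerivAt
  have hmem : ∀ η : tangentSpace M x, (x, (η : E)) ∈ tangentBundle M := fun η => ⟨hx, η.2⟩
  exact ⟨(norm_fderiv_comp_slice_le (hι η) hmem hJ h₁).trans hC₁,
    (norm_fderiv_fderiv_comp_slice_le hι hmem hJ (hnear.mono fun _ h => h.1) h₂).trans hC₂⟩

theorem IsRetraction.exists_norm_fderiv_le [FiniteDimensional ℝ E] {d : ℕ}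
    (hM : IsEmbeddedSubmanifold d M) (hR : IsRetraction M R) {N : Set E} (hN : IsCompact N)
    (hNM : N ⊆ M) (ρ : ℝ) : ∃ C : ℝ, ∀ x ∈ N, ∀ η : tangentSpace M x, ‖η‖ ≤ ρ →
      ‖fderiv ℝ (retractionAt M R x) η‖ ≤ C ∧
      ‖fderiv ℝ (fderiv ℝ (retractionAt M R x)) η‖ ≤ C := by
  have hsub := discBundle_subset_tangentBundle hNM ρ
  obtain ⟨C, hC⟩ := exists_forall_mem_of_isCompact (hM.isCompact_discBundle hN hNM ρ)
    (FibreDerivBound.monotone (R := R)) fun p hp =>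
      (hR.exists_eventually_fibreDerivBound (hsub hp)).imp fun _ h =>
        h.filter_mono (nhdsWithin_mono p hsub)
  exact ⟨C, fun x hx η hη => hC (x, η) ⟨hx, η.2, hη⟩ η rfl⟩

end Retraction

section Descent

variable {E : Type*} [NormedAddCommGroup E] [InnerProductSpace ℝ E] {M : Set E} {R : E → E → E}
  {f g : E → ℝ} {x : E}

theorem RetractionConvex.convexOn (hR : IsRetraction M R) (hg : RetractionConvex M R M g)
    (hx : x ∈ M) : ConvexOn ℝ Set.univ (g ∘ retractionAt M R x) :=
  convexOn_of_forall_exists_subgradient fun ξ =>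
    (hg x hx Set.univ (fun η _ => hR.retractionAt_mem hx η) ξ (Set.mem_univ ξ)).imp
      fun _ hζ η => hζ η (Set.mem_univ η)

/-- The set `Ω = {x ∈ M : F(x) ≤ α}` for the objective `F = f + g`. -/
def sublevelSet (M : Set E) (f g : E → ℝ) (α : ℝ) : Set E :=
  {y | y ∈ M ∧ f y + g y ≤ α}

variable [FiniteDimensional ℝ E] {α L l : ℝ}

theorem inner_riemGrad (M : Set E) (f : E → ℝ) (x : E) (η : tangentSpace M x) :
    inner ℝ (riemGrad M f x) η = fderivWithin ℝ f M x η := by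
  have := FiniteDimensional.complete ℝ (tangentSpace M x)
  rw [riemGrad, InnerProductSpace.toDual_symm_apply]
  rfl

theorem hasDerivAt_comp_retractionAt (hR : IsRetraction M R) (hf : DifferentiableOn ℝ f M)
    (hx : x ∈ M) (η : tangentSpace M x) :
    HasDerivAt (fun t : ℝ => f (retractionAt M R x (t • η))) (inner ℝ (riemGrad M f x) η) 0 := by
  rw [inner_riemGrad]
  refine HasFDerivWithinAt.comp_hasDerivAt (t := M) (0 : ℝ) ?_ (hR.hasDerivAt x hx η η.2)
    (Eventually.of_forall fun t => hR.retractionAt_mem hx (t • η))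
  rw [zero_smul, hR.retractionAt_zero hx]
  exact (hf x hx).hasFDerivWithinAt

theorem proxModel_zero (hR : IsRetraction M R) (hx : x ∈ M) :
    proxModel M R f g l x 0 = g x := by
  simp only [proxModel, inner_zero_right, norm_zero, Submodule.coe_zero, hR.map_zero x hx]
  ring

theorem convexOn_proxModel (hR : IsRetraction M R) (hg : RetractionConvex M R M g) (hx : x ∈ M)
    (hl : 0 ≤ l) : ConvexOn ℝ Set.univ (proxModel M R f g l x) := by
  have hlin : ConvexOn ℝ Set.univ fun η : tangentSpace M x => inner ℝ (riemGrad M f x) η :=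
    (innerₛₗ ℝ (riemGrad M f x)).convexOn convex_univ
  have hsq : ConvexOn ℝ Set.univ fun η : tangentSpace M x => ‖η‖ ^ 2 :=
    convexOn_univ_norm.pow (fun _ _ => norm_nonneg _) 2
  exact (hlin.add (hsq.smul (div_nonneg hl zero_le_two))).add (hg.convexOn hR hx)

theorem proxModel_smul_le (hR : IsRetraction M R) (hg : RetractionConvex M R M g) (hx : x ∈ M)
    (hl : 0 ≤ l) (η : tangentSpace M x) {t : ℝ} (ht₀ : 0 ≤ t) (ht₁ : t ≤ 1) :
    proxModel M R f g l x (t • η) ≤ g x + t * (proxModel M R f g l x η - g x) := by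
  have hsec := sub_le_mul_sub_of_convexOn (convexOn_proxModel (f := f) hR hg hx hl)
    (Set.mem_univ 0) (Set.mem_univ (0 + η)) ht₀ ht₁
  rw [zero_add, zero_add, proxModel_zero hR hx] at hsec
  linarith

theorem continuous_proxModel (hR : IsRetraction M R) (hg : Continuous g) (hx : x ∈ M) :
    Continuous (proxModel M R f g l x) := by
  have hgR : Continuous fun η : tangentSpace M x => g (R x η) :=
    hg.comp (hR.contDiff_retractionAt hx).continuous
  unfold proxModel
  exact Continuous.add (by fun_prop) hgR

theorem mul_norm_le_of_proxModel_le (hR : IsRetraction M R) {Lg : ℝ≥0} (hLg : LipschitzWith Lg g)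
    (hg : RetractionConvex M R M g) (hx : x ∈ M) {η : tangentSpace M x}
    (hη : proxModel M R f g l x η ≤ g x) :
    l * ‖η‖ ≤ 2 * (‖riemGrad M f x‖ + Lg) := by
  have hdecrease : g x - Lg * ‖η‖ ≤ g (R x η) := by
    have := sub_mul_norm_le_of_convexOn_comp hLg (hg.convexOn hR hx) (hR.hasDerivAt x hx η η.2)
    rwa [hR.retractionAt_zero hx] at this
  have hgrad := neg_le_of_abs_le (abs_real_inner_le_norm (riemGrad M f x) η)
  rw [proxModel] at hη
  rcases (norm_nonneg η).eq_or_lt with h₀ | hpos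
  · rw [← h₀, mul_zero]
    positivity
  · refine le_of_mul_le_mul_right ?_ hpos
    linarith

theorem RetractionSmooth.mono {N : Set E} {L' : ℝ} (hL : RetractionSmooth M R N L f)
    (hLL' : L ≤ L') : RetractionSmooth M R N L' f := fun x hx T hT η hη =>
  (hL x hx T hT η hη).trans (by gcongr)

theorem RetractionSmooth.le_add_proxModel {N : Set E} (hL : RetractionSmooth M R N L f)
    (hx : x ∈ N) {η : tangentSpace M x} (hη : R x η ∈ N) :
    f (R x η) + g (R x η) ≤ f x + proxModel M R f g L x η := by
  have := hL x hx {η} (by rintro _ rfl; exact hη) η rfl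
  rw [proxModel]
  linarith

theorem eventually_add_le_of_proxModel_lt (hR : IsRetraction M R) (hf : DifferentiableOn ℝ f M)
    (hg : RetractionConvex M R M g) (hL : 0 ≤ L) (hx : x ∈ M) {η : tangentSpace M x}
    (hη : proxModel M R f g L x η < g x) :
    ∀ᶠ t : ℝ in 𝓝[>] 0,
      f (retractionAt M R x (t • η)) + g (retractionAt M R x (t • η)) ≤ f x + g x := by
  have hslope := (hasDerivAt_comp_retractionAt hR hf hx η).tendsto_slope_zero.mono_left
    (nhdsGT_le_nhdsNE 0)
  filter_upwards [hslope.eventually_lt_const (lt_add_of_pos_right _ (sub_pos.2 hη)),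
    Ioo_mem_nhdsGT (zero_lt_one (α := ℝ))] with t ht ⟨ht₀, ht₁⟩
  have hmodel := proxModel_smul_le (f := f) hR hg hx hL η ht₀.le ht₁.le
  have hquad : 0 ≤ L / 2 * ‖t • η‖ ^ 2 := by positivity
  rw [zero_add, zero_smul, hR.retractionAt_zero hx, smul_eq_mul, inv_mul_lt_iff₀ ht₀] at ht
  rw [proxModel, inner_smul_right] at hmodel
  change f (retractionAt M R x (t • η)) + g (R x (t • η : tangentSpace M x)) ≤ f x + g x
  linarith

theorem RetractionSmooth.mem_sublevelSet_of_lt (hR : IsRetraction M R)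
    (hf : DifferentiableOn ℝ f M) (hgc : Continuous g) (hg : RetractionConvex M R M g)
    (hL₀ : 0 ≤ L) (hL : RetractionSmooth M R (sublevelSet M f g α) L f)
    (hx : x ∈ sublevelSet M f g α) {η : tangentSpace M x}
    (hη : proxModel M R f g L x η < g x) :
    R x η ∈ sublevelSet M f g α := by
  let curve : ℝ → E := fun t => retractionAt M R x (t • η)
  have hcurve : Continuous curve := (hR.contDiff_retractionAt hx.1).continuous.comp (by fun_prop)
  have hmem : ∀ t, curve t ∈ M := fun t => hR.retractionAt_mem hx.1 (t • η)
  have hlt : ∀ t ∈ Set.Ioo (0 : ℝ) 1, f (curve t) + g (curve t) ≤ α →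
      f (curve t) + g (curve t) < α := fun t ht hle => by
    have hmodel := proxModel_smul_le (f := f) hR hg hx.1 hL₀ η ht.1.le ht.2.le
    have hdecrease := mul_neg_of_pos_of_neg ht.1 (sub_neg.2 hη)
    calc f (curve t) + g (curve t) ≤ f x + proxModel M R f g L x (t • η) :=
          hL.le_add_proxModel hx ⟨hmem t, hle⟩
      _ < f x + g x := by linarith
      _ ≤ α := hx.2
  have hcurve₀ : f (curve 0) + g (curve 0) ≤ α := by
    simpa only [curve, zero_smul, hR.retractionAt_zero hx.1] using hx.2
  have hle := forall_mem_Icc_le_of_lt_of_le (h := fun t => f (curve t) + g (curve t))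
    ((hf.continuousOn.comp_continuous hcurve hmem).add (hgc.comp hcurve)) hcurve₀
    ((eventually_add_le_of_proxModel_lt hR hf hg hL₀ hx.1 hη).mono fun _ h => h.trans hx.2) hlt
    1 (Set.right_mem_Icc.2 zero_le_one)
  simp only [curve, one_smul] at hle
  exact ⟨hR.retractionAt_mem hx.1 η, hle⟩

theorem RetractionSmooth.mem_sublevelSet_of_le (hR : IsRetraction M R)
    (hf : DifferentiableOn ℝ f M) (hgc : Continuous g) (hg : RetractionConvex M R M g)
    (hL₀ : 0 ≤ L) (hL : RetractionSmooth M R (sublevelSet M f g α) L f) (hLl : L < l)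
    (hx : x ∈ sublevelSet M f g α) {η : tangentSpace M x}
    (hη : proxModel M R f g l x η ≤ g x) :
    R x η ∈ sublevelSet M f g α := by
  rcases eq_or_ne η 0 with rfl | hne
  · rwa [Submodule.coe_zero, hR.map_zero x hx.1]
  refine hL.mem_sublevelSet_of_lt hR hf hgc hg hL₀ hx ?_
  have hgap : 0 < (l - L) / 2 * ‖η‖ ^ 2 :=
    mul_pos (half_pos (sub_pos.2 hLl)) (pow_pos (norm_pos_iff.2 hne) 2)
  rw [proxModel] at hη ⊢
  linarith

theorem IsRetraction.exists_abs_sub_le {d : ℕ} (hM : IsEmbeddedSubmanifold d M)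
    (hR : IsRetraction M R) (hg : Continuous g) {N : Set E} (hN : IsCompact N) (hNM : N ⊆ M)
    (ρ : ℝ) : ∃ B, ∀ x ∈ N, ∀ η : tangentSpace M x, ‖η‖ ≤ ρ → |g (R x η) - g x| ≤ B := by
  have hcont : ContinuousOn (fun p : E × E => g (R p.1 p.2) - g p.1) (discBundle M N ρ) :=
    ((hg.comp_continuousOn hR.smooth.continuousOn).sub
      (hg.comp_continuousOn continuousOn_fst)).mono (discBundle_subset_tangentBundle hNM ρ)
  obtain ⟨B, hB⟩ := (hM.isCompact_discBundle hN hNM ρ).exists_bound_of_continuousOn hcont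
  exact ⟨B, fun x hx η hη => hB (x, η) ⟨hx, η.2, hη⟩⟩

theorem RetractionSmooth.exists_norm_riemGrad_le {d : ℕ} (hM : IsEmbeddedSubmanifold d M)
    (hR : IsRetraction M R) (hf : DifferentiableOn ℝ f M) (hgc : Continuous g)
    (hg : RetractionConvex M R M g) (hL₀ : 0 ≤ L) (hcpt : IsCompact (sublevelSet M f g α))
    (hL : RetractionSmooth M R (sublevelSet M f g α) L f) :
    ∃ D : ℝ, ∀ x ∈ sublevelSet M f g α, ‖riemGrad M f x‖ ≤ D := by
  have hΩM : sublevelSet M f g α ⊆ M := fun _ hy => hy.1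
  obtain ⟨D, hD⟩ := hcpt.exists_bound_of_continuousOn (hf.continuousOn.mono hΩM)
  obtain ⟨B, hB⟩ := hR.exists_abs_sub_le hM hgc hcpt hΩM 1
  refine ⟨max 0 (max (L / 2 + B) (2 * D + L / 2)), fun x hx => ?_⟩
  -- Otherwise the unit steepest descent step stays in `Ω` and decreases `f` by more than `2 D`.
  by_contra! hlarge
  obtain ⟨hpos, hlarge⟩ := max_lt_iff.1 hlarge
  obtain ⟨hLB, hLD⟩ := max_lt_iff.1 hlarge
  set p := riemGrad M f x with hp
  let η : tangentSpace M x := -(‖p‖⁻¹ • p)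
  have hη : ‖η‖ = 1 := by
    rw [norm_neg, norm_smul, norm_inv, norm_norm, inv_mul_cancel₀ hpos.ne']
  have hpη : inner ℝ p η = -‖p‖ := by
    rw [inner_neg_right, inner_smul_right, real_inner_self_eq_norm_sq]
    field_simp
  have hmodel : proxModel M R f g L x η = -‖p‖ + L / 2 + g (R x η) := by
    rw [proxModel, ← hp, hpη, hη, one_pow, mul_one]
  have hmem : R x η ∈ sublevelSet M f g α := by
    refine hL.mem_sublevelSet_of_lt hR hf hgc hg hL₀ hx ?_
    rw [hmodel]
    linarith [le_of_abs_le (hB x hx η hη.le)]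
  have hdecrease := hL.le_add_proxModel (g := g) hx hmem
  rw [hmodel] at hdecrease
  linarith [neg_le_of_abs_le (hD _ hmem), le_of_abs_le (hD x hx)]

end Descent

section ErrorBound

variable {E : Type*} [NormedAddCommGroup E] [InnerProductSpace ℝ E] [FiniteDimensional ℝ E]
  {M : Set E} {R : E → E → E} {f g : E → ℝ} {x : E} {L l : ℝ} {Lg : ℝ≥0}

/-- The linearized model on `T_x M` itself, without a frame; the vector transport `𝒯_{R_η}` is
written as the differential of `R_x` at `η`. -/
noncomputable def tangentLinModel (M : Set E) (R : E → E → E) (f g : E → ℝ) (l : ℝ) (x : E)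
    (η ξ : tangentSpace M x) : ℝ :=
  inner ℝ (riemGrad M f x + l • η) ξ + l / 2 * ‖fderiv ℝ (retractionAt M R x) η ξ‖ ^ 2
    + g (R x η + fderiv ℝ (retractionAt M R x) η ξ)

theorem norm_sub_le_of_isMinOn_tangentLinModel (hR : IsRetraction M R)
    (hgconv : ConvexOn ℝ Set.univ g) (hgLip : LipschitzWith Lg g) (hgR : RetractionConvex M R M g)
    (hx : x ∈ M) {C ρ : ℝ}
    (hC : ∀ η, ‖η‖ ≤ 3 * ρ → ‖fderiv ℝ (retractionAt M R x) η‖ ≤ C ∧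
      ‖fderiv ℝ (fderiv ℝ (retractionAt M R x)) η‖ ≤ C)
    (hl : 0 < l) (hlC : 2 * (Lg * C) ≤ l) {η ηstar ξ : tangentSpace M x} (hη : ‖η‖ ≤ ρ)
    (hηstar : ‖ηstar‖ ≤ ρ) (hmin : IsMinOn (proxModel M R f g l x) Set.univ ηstar)
    (hξ : IsMinOn (tangentLinModel M R f g l x η) Set.univ ξ) :
    ‖η - ηstar‖ ≤ (2 * C ^ 2 + 3) * ‖ξ‖ := by
  let A := fderiv ℝ (retractionAt M R x) η
  have hφ : ConvexOn ℝ Set.univ fun v => g (R x η + A v) :=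
    (hgconv.translate_right (R x η)).comp_linearMap (A : tangentSpace M x →ₗ[ℝ] E)
  have hball : ∀ z ∈ Metric.closedBall (0 : tangentSpace M x) (3 * ρ),
      ‖fderiv ℝ (fderiv ℝ (retractionAt M R x)) z‖ ≤ C :=
    fun z hz => (hC z (mem_closedBall_zero_iff.1 hz)).2
  have hmodel : ∀ v, ‖v‖ ≤ 2 * ρ →
      |(g ∘ retractionAt M R x) (η + v) - g (R x η + A v)| ≤ Lg * C * ‖v‖ ^ 2 := fun v hv => by
    have htaylor := norm_sub_sub_fderiv_le (hR.contDiff_retractionAt hx)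
      (convex_closedBall 0 (3 * ρ)) hball (x := η) (y := η + v)
      (mem_closedBall_zero_iff.2 (by linarith [norm_nonneg η]))
      (mem_closedBall_zero_iff.2 ((norm_add_le η v).trans (by linarith)))
    rw [add_sub_cancel_left, sub_sub] at htaylor
    calc |g (retractionAt M R x (η + v)) - g (R x η + A v)|
        ≤ Lg * ‖retractionAt M R x (η + v) - (R x η + A v)‖ := hgLip.norm_sub_le _ _
      _ ≤ Lg * (C * ‖v‖ ^ 2) := by gcongr; exact htaylor
      _ = Lg * C * ‖v‖ ^ 2 := by ring
  rw [norm_sub_rev]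
  exact norm_sub_le_mul_norm_of_isMinOn (hgR.convexOn hR hx) hφ hl hlC
    (hC η (by linarith [norm_nonneg η])).1 hmodel ((norm_sub_le _ _).trans (by linarith)) hmin hξ

theorem RetractionSmooth.exists_norm_sub_le {d : ℕ} {α : ℝ} (hM : IsEmbeddedSubmanifold d M)
    (hR : IsRetraction M R) (hf : DifferentiableOn ℝ f M) (hgconv : ConvexOn ℝ Set.univ g)
    (hgLip : LipschitzWith Lg g) (hgR : RetractionConvex M R M g) (hL₀ : 0 ≤ L)
    (hcpt : IsCompact (sublevelSet M f g α)) (hL : RetractionSmooth M R (sublevelSet M f g α) L f) :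
    ∃ L₀ a : ℝ, 0 < a ∧ ∀ l, 0 < l → L₀ < l → ∀ x ∈ sublevelSet M f g α,
      ∀ η ηstar ξ : tangentSpace M x, proxModel M R f g l x η ≤ g x →
        0 ∈ clarkeSubdiff (proxModel M R f g l x) ηstar →
        IsMinOn (tangentLinModel M R f g l x η) Set.univ ξ → ‖η - ηstar‖ ≤ a * ‖ξ‖ := by
  obtain ⟨D, hD⟩ := hL.exists_norm_riemGrad_le hM hR hf hgLip.continuous hgR hL₀ hcpt
  obtain ⟨C, hC⟩ := hR.exists_norm_fderiv_le hM hcpt (fun _ hy => hy.1) (3 * 1)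
  refine ⟨max (2 * (Lg * C)) (2 * (D + Lg)), 2 * C ^ 2 + 3, by positivity,
    fun l hl hlarge x hx η ηstar ξ hη hstar hξ => ?_⟩
  obtain ⟨hlC, hlD⟩ := max_lt_iff.1 hlarge
  have hmin : IsMinOn (proxModel M R f g l x) Set.univ ηstar :=
    isMinOn_of_zero_mem_clarkeSubdiff (convexOn_proxModel hR hgR hx.1 hl.le)
      (continuous_proxModel hR hgLip.continuous hx.1) hstar
  have hshort : ∀ ζ, proxModel M R f g l x ζ ≤ g x → ‖ζ‖ ≤ 1 := fun ζ hζ => by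
    have hlζ := mul_norm_le_of_proxModel_le hR hgLip hgR hx.1 hζ
    refine le_of_mul_le_mul_left ?_ hl
    linarith [hD x hx]
  have hstar_le : proxModel M R f g l x ηstar ≤ g x :=
    (isMinOn_univ_iff.1 hmin 0).trans_eq (proxModel_zero hR hx.1)
  exact norm_sub_le_of_isMinOn_tangentLinModel hR hgconv hgLip hgR hx.1 (hC x hx) hl hlC.le
    (hshort η hη) (hshort ηstar hstar_le) hmin hξ

end ErrorBound

section Frame

variable {E : Type*} [NormedAddCommGroup E] [InnerProductSpace ℝ E] {d : ℕ} {M : Set E}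
  {R : E → E → E} {f g : E → ℝ} {x : E} {l : ℝ} {Q : E → EuclideanSpace ℝ (Fin d) →ₗᵢ[ℝ] E}

/-- The frame `Q_x` as an isometry of `ℝ^d` onto the type `tangentSpace M x`. -/
noncomputable def IsFrame.toTangent (hQ : IsFrame M Q) (hx : x ∈ M) :
    EuclideanSpace ℝ (Fin d) ≃ₗᵢ[ℝ] tangentSpace M x :=
  (Q x).equivRange.trans (LinearIsometryEquiv.ofEq _ _ (hQ x hx))

theorem IsFrame.coe_toTangent (hQ : IsFrame M Q) (hx : x ∈ M) (c : EuclideanSpace ℝ (Fin d)) :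
    (hQ.toTangent hx c : E) = Q x c :=
  rfl

variable [FiniteDimensional ℝ E]

theorem IsFrame.proxModel_toTangent (hQ : IsFrame M Q) (hx : x ∈ M)
    (c : EuclideanSpace ℝ (Fin d)) :
    proxModel M R f g l x (hQ.toTangent hx c) = proxModelCoord M R f g l Q x c := by
  rw [proxModel, proxModelCoord, LinearIsometryEquiv.norm_map, Submodule.coe_inner,
    hQ.coe_toTangent]

theorem IsFrame.tangentLinModel_toTangent (hQ : IsFrame M Q) (hR : IsRetraction M R) (hx : x ∈ M)
    (c v : EuclideanSpace ℝ (Fin d)) :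
    tangentLinModel M R f g l x (hQ.toTangent hx c) (hQ.toTangent hx v) =
      linModel M R f g l Q x c v := by
  rw [linModel, tangentLinModel, ← hR.diffRetraction_eq_fderiv hx, Submodule.coe_inner,
    real_inner_comm]
  rfl

theorem IsLinResidual.isMinOn_tangentLinModel {c r : EuclideanSpace ℝ (Fin d)}
    (hr : IsLinResidual M R f g l Q x c r) (hQ : IsFrame M Q) (hR : IsRetraction M R)
    (hx : x ∈ M) :
    IsMinOn (tangentLinModel M R f g l x (hQ.toTangent hx c)) Set.univ (hQ.toTangent hx r) := by
  refine isMinOn_univ_iff.2 ((hQ.toTangent hx).surjective.forall.2 fun v => ?_)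
  rw [hQ.tangentLinModel_toTangent hR, hQ.tangentLinModel_toTangent hR]
  exact isMinOn_univ_iff.1 hr v

theorem IsIterates.proxModel_le {x₀ : E} {x : ℕ → E} {c : ℕ → EuclideanSpace ℝ (Fin d)}
    (hit : IsIterates M R f g l Q x₀ x c) (hQ : IsFrame M Q) (hR : IsRetraction M R) {k : ℕ}
    (hk : x k ∈ M) : proxModel M R f g l (x k) (hQ.toTangent hk (c k)) ≤ g (x k) := by
  rw [← proxModel_zero (f := f) (g := g) (l := l) hR hk, ← map_zero (hQ.toTangent hk),
    hQ.proxModel_toTangent, hQ.proxModel_toTangent]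
  exact hit.descent k

theorem IsIterates.mem_sublevelSet {α L : ℝ} {x₀ : E} {x : ℕ → E}
    {c : ℕ → EuclideanSpace ℝ (Fin d)} (hit : IsIterates M R f g l Q x₀ x c) (hQ : IsFrame M Q)
    (hR : IsRetraction M R) (hf : DifferentiableOn ℝ f M) (hgc : Continuous g)
    (hg : RetractionConvex M R M g) (hL₀ : 0 ≤ L)
    (hL : RetractionSmooth M R (sublevelSet M f g α) L f) (hLl : L < l)
    (hx₀ : x₀ ∈ sublevelSet M f g α) (k : ℕ) : x k ∈ sublevelSet M f g α := by
  induction k with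
  | zero => rwa [hit.init]
  | succ k hk =>
    rw [hit.step k]
    exact hL.mem_sublevelSet_of_le hR hf hgc hg hL₀ hLl hk (hit.proxModel_le hQ hR hk.1)

end Frame

section Accuracy

variable {a e r ε : ℝ}

theorem le_sqrt_mul_sq_of_le_mul (ha : 0 ≤ a) (he : e ≤ a * r) (hr : r ≤ ε ^ 2) :
    e ≤ (√a * ε) ^ 2 :=
  calc e ≤ a * ε ^ 2 := he.trans (mul_le_mul_of_nonneg_left hr ha)
    _ = (√a * ε) ^ 2 := by rw [mul_pow, Real.sq_sqrt ha]

theorem le_min_sq_of_le_mul {n β γ ρ : ℝ} (ha : 0 < a) (he : e ≤ a * r) (hρ : ρ < β / (γ * a))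
    (hr : r ≤ min (ε ^ 2) (ρ * n ^ 2)) : e ≤ min ((√a * ε) ^ 2) (β / γ * n ^ 2) := by
  refine le_min (le_sqrt_mul_sq_of_le_mul ha.le he (hr.trans (min_le_left _ _))) ?_
  have haρ : a * ρ ≤ β / γ := by
    rw [mul_comm, ← le_div_iff₀ ha, div_div]
    exact hρ.le
  calc e ≤ a * (ρ * n ^ 2) :=
        he.trans (mul_le_mul_of_nonneg_left (hr.trans (min_le_right _ _)) ha.le)
    _ = a * ρ * n ^ 2 := by ring
    _ ≤ β / γ * n ^ 2 := by gcongr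

end Accuracy

end IRPG

theorem theorem4p2_general {E : Type*} [NormedAddCommGroup E] [InnerProductSpace ℝ E]
    [FiniteDimensional ℝ E] {d : ℕ}
    (M : Set E) (hM : IRPG.IsEmbeddedSubmanifold d M)
    (R : E → E → E) (hR : IRPG.IsRetraction M R)
    (f g : E → ℝ) (hf : DifferentiableOn ℝ f M)
    (x₀ : E) (hx₀ : x₀ ∈ M)
    (hcpt : IsCompact {y | y ∈ M ∧ f y + g y ≤ f x₀ + g x₀})
    (L : ℝ) (hL : IRPG.RetractionSmooth M R {y | y ∈ M ∧ f y + g y ≤ f x₀ + g x₀} L f)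
    (hgconv : ConvexOn ℝ Set.univ g) (Lg : NNReal) (hgLip : LipschitzWith Lg g)
    (hgR : IRPG.RetractionConvex M R M g) :
    ∃ L₀ a : ℝ, 0 < a ∧ ∀ Lt : ℝ, L₀ < Lt →
      ∀ (Q : E → EuclideanSpace ℝ (Fin d) →ₗᵢ[ℝ] E) (x : ℕ → E)
        (c r : ℕ → EuclideanSpace ℝ (Fin d)) (ηstar : ∀ k, IRPG.tangentSpace M (x k)),
        IRPG.IsFrame M Q →
        IRPG.IsIterates M R f g Lt Q x₀ x c →
        (∀ k, IRPG.IsLinResidual M R f g Lt Q (x k) (c k) (r k)) →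
        (∀ k, 0 ∈ IRPG.clarkeSubdiff (IRPG.proxModel M R f g Lt (x k)) (ηstar k)) →
        ∀ k, ‖Q (x k) (c k) - ηstar k‖ ≤ a * ‖r k‖ := by
  have hL' := hL.mono (le_max_left L 0)
  obtain ⟨L₀, a, ha, hbound⟩ :=
    hL'.exists_norm_sub_le hM hR hf hgconv hgLip hgR (le_max_right L 0) hcpt
  refine ⟨max (max L 0) L₀, a, ha, fun Lt hLt Q x c r ηstar hQ hit hr hstar k => ?_⟩
  obtain ⟨hLLt, hL₀Lt⟩ := max_lt_iff.1 hLt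
  have hxk := hit.mem_sublevelSet hQ hR hf hgLip.continuous hgR (le_max_right L 0) hL' hLLt
    ⟨hx₀, le_rfl⟩ k
  have herr := hbound Lt ((le_max_right L 0).trans_lt hLLt) hL₀Lt (x k) hxk _ _ _
    (hit.proxModel_le hQ hR hxk.1) (hstar k) ((hr k).isMinOn_tangentLinModel hQ hR hxk.1)
  rwa [LinearIsometryEquiv.norm_map] at herr

theorem theorem4p2 {E : Type*} [NormedAddCommGroup E] [InnerProductSpace ℝ E]
    [FiniteDimensional ℝ E] {d : ℕ}
    (M : Set E) (hM : IRPG.IsEmbeddedSubmanifold d M)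
    (R : E → E → E) (hR : IRPG.IsRetraction M R)
    (f g : E → ℝ) (hf : DifferentiableOn ℝ f M)
    (x₀ : E) (hx₀ : x₀ ∈ M)
    -- the objective is bounded below on `M` and its sublevel set at `x₀` is compact
    (hbdd : BddBelow ((fun y => f y + g y) '' M))
    (hcpt : IsCompact {y | y ∈ M ∧ f y + g y ≤ f x₀ + g x₀})
    -- `f` is `L`-retraction-smooth in the sublevel set
    (L : ℝ) (hL : IRPG.RetractionSmooth M R {y | y ∈ M ∧ f y + g y ≤ f x₀ + g x₀} L f)
    -- `g` is convex and Lipschitz in the Euclidean sense, and retraction-convex on `M`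
    (hgconv : ConvexOn ℝ Set.univ g) (Lg : NNReal) (hgLip : LipschitzWith Lg g)
    (hgR : IRPG.RetractionConvex M R M g) :
    ∃ L₀ : ℝ, ∀ Lt : ℝ, L₀ < Lt → ∃ a : ℝ, 0 < a ∧
      ∀ (Q : E → EuclideanSpace ℝ (Fin d) →ₗᵢ[ℝ] E) (x : ℕ → E)
        (c r : ℕ → EuclideanSpace ℝ (Fin d))
        (ηstar : ∀ k, IRPG.tangentSpace M (x k)) (ε : ℕ → ℝ) (U : Set E),
        IRPG.IsFrame M Q →
        IRPG.IsIterates M R f g Lt Q x₀ x c →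
        -- `U` is a parallelizable neighbourhood in `M` of the set of accumulation points
        U ⊆ M → (∃ V : Set E, IsOpen V ∧ IRPG.accPoints M x ⊆ V ∧ V ∩ M ⊆ U) →
        IRPG.IsParallelizable Q U →
        -- `r k` is the linearized residual at `c k`, and `ηstar k` is a stationary point of the
        -- proximal model
        (∀ k, IRPG.IsLinResidual M R f g Lt Q (x k) (c k) (r k)) →
        (∀ k, 0 ∈ IRPG.clarkeSubdiff (IRPG.proxModel M R f g Lt (x k)) (ηstar k)) →
        (∀ k, 0 < ε k) →
        (∀ (ψ : ℝ → ℝ → ℝ → ℝ) (ρ : ℝ), (∀ k, ‖r k‖ ≤ ψ (ε k) ρ ‖c k‖) →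
          ∃ K : ℕ, 0 < K ∧ ∀ k, K < k →
            ‖Q (x k) (c k) - ηstar k‖ ≤ a * ψ (ε k) ρ ‖Q (x k) (c k)‖) ∧
        ((∀ k, ‖r k‖ ≤ ε k ^ 2) →
          ∃ κ : ℝ, 0 < κ ∧ ∀ k, ‖Q (x k) (c k) - ηstar k‖ ≤ (κ * ε k) ^ 2) ∧
        (∀ ρ LF : ℝ, 0 < LF → ρ < ((Lt - L) / 2) / (2 * LF * a) →
          (∀ k, ‖r k‖ ≤ min (ε k ^ 2) (ρ * ‖c k‖ ^ 2)) →
          ∃ K : ℕ, 0 < K ∧ ∀ k, K < k →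
            ‖Q (x k) (c k) - ηstar k‖ ≤
              min ((√a * ε k) ^ 2) (((Lt - L) / 2) / (2 * LF) * ‖Q (x k) (c k)‖ ^ 2)) := by
  obtain ⟨L₀, a, ha, hbound⟩ :=
    theorem4p2_general M hM R hR f g hf x₀ hx₀ hcpt L hL hgconv Lg hgLip hgR
  refine ⟨L₀, fun Lt hLt => ⟨a, ha, fun Q x c r ηstar ε U hQ hit _ _ _ hr hstar _ => ?_⟩⟩
  have herr := hbound Lt hLt Q x c r ηstar hQ hit hr hstar
  simp only [LinearIsometry.norm_map]
  exact ⟨fun ψ ρ hψ => ⟨1, one_pos, fun k _ => (herr k).trans (by gcongr; exact hψ k)⟩,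
    fun hε => ⟨√a, Real.sqrt_pos.2 ha, fun k =>
      IRPG.le_sqrt_mul_sq_of_le_mul ha.le (herr k) (hε k)⟩,
    fun ρ LF _ hρ hmin => ⟨1, one_pos, fun k _ =>
      IRPG.le_min_sq_of_le_mul ha (herr k) hρ (hmin k)⟩⟩
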